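/- Let $n\ge 1$, let $\Omega\subseteq\mathbb{R}^n$ be a nonempty open set, let $1<p<\infty$ and $s\in\mathbb{R}$ with $sp>n$ (so $s>0$). Assume that $\Omega=\mathbb{R}^n$, or that $\Omega$ is bounded with Lipschitz continuous boundary, or, more generally, that $\Omega$ has the interior Lipschitz property: for every compact $K\subseteq\Omega$ there is a bounded open set $\Omega'$ with Lipschitz continuous boundary such that $K\subseteq\Omega'\subseteq\Omega$. For $s=k+\theta$ with $k\in\mathbb{N}_0$ and $0\le\theta<1$, let $W^{s,p}(\Omega)$ be the space of all real-valued $f\in L^p(\Omega)$ whose weak derivatives $\partial^\nu f$ with $|\nu|\le k$ lie in $L^p(\Omega)$ and, if $\theta>0$, satisfy $\int_\Omega\int_\Omega \frac{|\partial^\nu f(x)-\partial^\nu f(y)|^p}{|x-y|^{n+\theta p}}\,dx\,dy<\infty$ for all $|\nu|=k$. Let $W^{s,p}_{loc}(\Omega)$ be the space of distributions $u\in D'(\Omega)$ such that $\varphi u\in W^{s,p}(\Omega)$ for all $\varphi\in C_c^\infty(\Omega)$. Then every $u\in W^{s,p}_{loc}(\Omega)$ has a continuous version: there is a continuous function $v:\Omega\to\mathbb{R}$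 such that $u(\psi)=\int_\Omega v\,\psi\,dx$ for all $\psi\in C_c^\infty(\Omega)$, and every locally integrable function on $\Omega$ that represents $u$ in this way equals $v$ almost everywhere on $\Omega$. -/

import Mathlib

open MeasureTheory TopologicalSpace
open scoped Distributions LineDeriv InnerProductSpace

/-- `Ω ⊆ ℝⁿ` has Lipschitz continuous boundary: near every boundary point, in suitable orthonormal
coordinates, `Ω` is the set of points strictly below the graph of a Lipschitz function. The last
coordinate of `y` in the new system is `⟪e, y⟫`, the remaining ones form the orthogonal projection
`y - ⟪e, y⟫ • e` of `y` to the hyperplane orthogonal to `e`; only the values of `γ` on that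
hyperplane matter. -/
def HasLipschitzBoundary {n : ℕ} (Ω : Set (EuclideanSpace ℝ (Fin n))) : Prop :=
  ∀ x ∈ frontier Ω, ∃ (e : EuclideanSpace ℝ (Fin n)) (r : ℝ) (L : NNReal)
    (γ : EuclideanSpace ℝ (Fin n) → ℝ), ‖e‖ = 1 ∧ 0 < r ∧ LipschitzWith L γ ∧
      ∀ y ∈ Metric.ball x r, (y ∈ Ω ↔ ⟪e, y⟫_ℝ < γ (y - ⟪e, y⟫_ℝ • e))

/-- The interior Lipschitz property: every compact subset of `Ω` lies in a bounded open subset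
of `Ω` with Lipschitz continuous boundary. -/
def HasInteriorLipschitzProperty {n : ℕ} (Ω : Opens (EuclideanSpace ℝ (Fin n))) : Prop :=
  ∀ K : Set (EuclideanSpace ℝ (Fin n)), IsCompact K → K ⊆ (Ω : Set (EuclideanSpace ℝ (Fin n))) →
    ∃ Ω' : Opens (EuclideanSpace ℝ (Fin n)), Bornology.IsBounded (Ω' : Set (EuclideanSpace ℝ (Fin n)))
      ∧ HasLipschitzBoundary (Ω' : Set (EuclideanSpace ℝ (Fin n))) ∧ Ω' ≤ Ω
      ∧ K ⊆ (Ω' : Set (EuclideanSpace ℝ (Fin n)))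

/-- The product of two real test functions on `Ω`. -/
noncomputable def TestFunction.pointwiseMul {n : ℕ} {Ω : Opens (EuclideanSpace ℝ (Fin n))} (φ ψ : 𝓓(Ω, ℝ)) :
    𝓓(Ω, ℝ) where
  toFun x := φ x * ψ x
  contDiff' := φ.contDiff.mul ψ.contDiff
  hasCompactSupport' := φ.hasCompactSupport.mul_right
  tsupport_subset' := (tsupport_mul_subset_left (f := fun x => φ x)).trans φ.tsupport_subset

/-- The product `φ u` of a distribution `u` with a test function `φ`, as a linear functional on
test functions: `⟨φ u, ψ⟩ = ⟨u, φ ψ⟩`. -/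
noncomputable def Distribution.smulTest {n : ℕ} {Ω : Opens (EuclideanSpace ℝ (Fin n))} (φ : 𝓓(Ω, ℝ))
    (u : 𝓓'(Ω, ℝ)) : 𝓓(Ω, ℝ) →ₗ[ℝ] ℝ where
  toFun ψ := u (φ.pointwiseMul ψ)
  map_add' ψ₁ ψ₂ := by
    rw [← map_add]
    congr 1
    ext x
    exact mul_add (φ x) (ψ₁ x) (ψ₂ x)
  map_smul' c ψ := by
    rw [RingHom.id_apply, ← map_smul]
    congr 1
    ext x
    exact mul_left_comm (φ x) c (ψ x)

/-- The functional `T` is the one given by the locally integrable function `f` on `Ω`. -/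
def IsGivenBy {n : ℕ} {Ω : Opens (EuclideanSpace ℝ (Fin n))} (T : 𝓓(Ω, ℝ) →ₗ[ℝ] ℝ)
    (f : EuclideanSpace ℝ (Fin n) → ℝ) : Prop :=
  LocallyIntegrableOn f (Ω : Set (EuclideanSpace ℝ (Fin n))) volume ∧
    ∀ ψ : 𝓓(Ω, ℝ), T ψ = ∫ x in (Ω : Set (EuclideanSpace ℝ (Fin n))), f x * ψ x

/-- `g` is the weak (distributional) derivative `∂_{ν 0} ⋯ ∂_{ν (m-1)} f` of order `m` on `Ω`.
The multi-index is given as a list `ν` of `m` coordinate directions; since partial derivatives of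
test functions commute, these are exactly the derivatives `∂^α f` with `|α| = m`. -/
def IsWeakDeriv {n : ℕ} (Ω : Opens (EuclideanSpace ℝ (Fin n))) {m : ℕ} (ν : Fin m → Fin n)
    (f g : EuclideanSpace ℝ (Fin n) → ℝ) : Prop :=
  ∀ ψ : 𝓓(Ω, ℝ),
    ∫ x in (Ω : Set (EuclideanSpace ℝ (Fin n))),
        f x * (∂^{fun i => EuclideanSpace.single (ν i) (1 : ℝ)} ψ) x
      = (-1) ^ m * ∫ x in (Ω : Set (EuclideanSpace ℝ (Fin n))), g x * ψ x

/-- The `p`-th power of the Gagliardo–Slobodeckij seminorm `|g|_{W^{θ,p}(Ω)}`. -/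
noncomputable def slobodeckijEnergy {n : ℕ} (Ω : Opens (EuclideanSpace ℝ (Fin n))) (θ p : ℝ)
    (g : EuclideanSpace ℝ (Fin n) → ℝ) : ENNReal :=
  ∫⁻ x in (Ω : Set (EuclideanSpace ℝ (Fin n))), ∫⁻ y in (Ω : Set (EuclideanSpace ℝ (Fin n))),
    ENNReal.ofReal (|g x - g y| ^ p / ‖x - y‖ ^ ((n : ℝ) + θ * p))

/-- `f ∈ W^{s,p}(Ω)` for `s ≥ 0` and `1 < p < ∞`, with `k = ⌊s⌋` and `θ = s - ⌊s⌋`: all weak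
derivatives of `f` of order at most `k` (including `f` itself) exist and lie in `L^p(Ω)`, and if
`θ > 0`, those of order exactly `k` have finite Slobodeckij seminorm of exponent `θ`. -/
def MemSobolevSlobodeckij {n : ℕ} (Ω : Opens (EuclideanSpace ℝ (Fin n))) (s p : ℝ)
    (f : EuclideanSpace ℝ (Fin n) → ℝ) : Prop :=
  MemLp f (ENNReal.ofReal p) (volume.restrict (Ω : Set (EuclideanSpace ℝ (Fin n)))) ∧
    ∀ m ≤ ⌊s⌋₊, ∀ ν : Fin m → Fin n, ∃ g : EuclideanSpace ℝ (Fin n) → ℝ,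
      MemLp g (ENNReal.ofReal p) (volume.restrict (Ω : Set (EuclideanSpace ℝ (Fin n)))) ∧
      IsWeakDeriv Ω ν f g ∧
      (m = ⌊s⌋₊ → 0 < s - ⌊s⌋₊ → slobodeckijEnergy Ω (s - ⌊s⌋₊) p g < ⊤)

/-- The distribution `u` lies in `W^{s,p}_loc(Ω)` (for `s ≥ 0`): for every `φ ∈ C_c^∞(Ω)` the
distribution `φ u` is (given by) an element of `W^{s,p}(Ω)`. -/
def MemSobolevSlobodeckijLoc {n : ℕ} {Ω : Opens (EuclideanSpace ℝ (Fin n))} (s p : ℝ)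
    (u : 𝓓'(Ω, ℝ)) : Prop :=
  ∀ φ : 𝓓(Ω, ℝ), ∃ f : EuclideanSpace ℝ (Fin n) → ℝ,
    IsGivenBy (Distribution.smulTest φ u) f ∧ MemSobolevSlobodeckij Ω s p f

/-! The question is local, so it reduces to each `φ u`, given by some `f ∈ W^{s,p}(Ω)`, and to
gluing the continuous versions obtained. Write `s = k + θ`. The continuous version of `f` is the
limit of its mollifications `T_j` at the scales `t = 2^{-j}`, for a tensor mollifier `ρ = a ⊗ ⋯ ⊗
a`.

The choice of `a` is what makes this work: `2 a(2x) - a(x)` is the derivative of order `k + 1` of a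
smooth compactly supported `b` (`exists_mollifier_dilation_sub_eq_iteratedDeriv`). Telescoping the
product over coordinates writes `T_{j+1} - T_j` as a sum over `i` of pairings of `f` with a `k`-th
pure derivative in direction `i`. Moving these derivatives onto `f` gives `t^k` times averages of
`∂_i^k f` against kernels with a factor `b'` (`kernelAverage_half_sub`). That factor makes the
kernels mean zero, so the Slobodeckij energy (or the `L^p` norm when `θ = 0`) bounds each average by
a multiple of `t^{θ - n/p}` (`exists_abs_setIntegral_mul_kernel_le`).

Hence `|T_{j+1} - T_j| ≤ C t^{s - n/p}` wherever the ball of radius `R t` stays in `Ω`. As `s p >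
n`, this is geometric decay, so `T_j` converges locally uniformly on `Ω`; Lebesgue differentiation
identifies the limit with `f` almost everywhere. -/

/-! ### One-dimensional mollifiers. -/

open scoped ContDiff in
/-- A smooth compactly supported function on `ℝ` with zero integral has a smooth compactly
supported primitive. -/
lemma exists_contDiff_hasCompactSupport_deriv_eq {g : ℝ → ℝ} (hg : ContDiff ℝ ∞ g)
    (hc : HasCompactSupport g) (h0 : ∫ x, g x = 0) :
    ∃ h : ℝ → ℝ, ContDiff ℝ ∞ h ∧ HasCompactSupport h ∧ deriv h = g := by
  obtain ⟨R, hR⟩ := hc.isCompact.isBounded.subset_closedBall 0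
  have hz : ∀ x, R < |x| → g x = 0 := fun x hx => by
    refine image_eq_zero_of_notMem_tsupport fun h => ?_
    have := hR h
    rw [mem_closedBall_zero_iff, Real.norm_eq_abs] at this
    linarith
  have hd : ∀ x, HasDerivAt (fun x => ∫ t in (-R)..x, g t) (g x) x := fun x =>
    hg.continuous.integral_hasStrictDerivAt _ x |>.hasDerivAt
  have hderiv : deriv (fun x => ∫ t in (-R)..x, g t) = g := funext fun x => (hd x).deriv
  refine ⟨fun x => ∫ t in (-R)..x, g t, ?_, ?_, hderiv⟩
  · rw [contDiff_infty_iff_deriv, hderiv]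
    exact ⟨fun x => (hd x).differentiableAt, hg⟩
  -- `|R|` rather than `R`: the radius may be negative when `g = 0`.
  · refine HasCompactSupport.intro (isCompact_closedBall (0 : ℝ) |R|) fun x hx => ?_
    rw [mem_closedBall_zero_iff, Real.norm_eq_abs, not_le] at hx
    have hRx : R < |x| := (le_abs_self R).trans_lt hx
    rcases lt_or_ge x 0 with hx0 | hx0
    · rw [abs_of_neg hx0] at hRx hx
      refine intervalIntegral.integral_zero_ae (.of_forall fun t ht => ?_)
      rw [Set.uIoc_of_ge (by linarith)] at ht
      rcases lt_or_eq_of_le ht.2 with h | h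
      · exact hz t (by linarith [neg_le_abs t])
      · subst h
        -- At the endpoint `-R` the vanishing of `g` follows by continuity from the points to its
        -- left.
        by_contra hne
        have : -R ∈ closure {t : ℝ | R < |t|} := by
          have : -R ∈ closure (Set.Ioo x (-R)) := by
            rw [closure_Ioo (by linarith)]; exact ⟨by linarith, le_rfl⟩
          exact closure_mono (fun t ht => by
            have := neg_le_abs t
            have := ht.2
            change R < |t|; linarith) this
        exact hne (closure_minimal hz (isClosed_eq hg.continuous continuous_const) this)
    · rw [abs_of_nonneg hx0] at hRx hx
      have hs : Function.support g ⊆ Set.Icc (-R) x := fun t ht => by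
        have : |t| ≤ R := by
          by_contra h
          exact ht (hz t (not_le.1 h))
        exact ⟨by linarith [neg_abs_le t], by linarith [le_abs_self t]⟩
      rcases le_total (-R) x with h | h
      · rw [intervalIntegral.integral_of_le h, ← integral_Icc_eq_integral_Ioc,
          setIntegral_eq_integral_of_forall_compl_eq_zero, h0]
        exact fun t ht => by
          by_contra h'
          exact ht (hs h')
      · rw [abs_of_nonpos (by linarith : R ≤ 0)] at hx
        linarith

open scoped ContDiff in
/-- For every `m` there is a mollifier `a` on `ℝ` whose difference with its dilation by `1/2` is the
derivative of order `m + 1` of a smooth compactly supported function. -/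
lemma exists_mollifier_dilation_sub_eq_iteratedDeriv (m : ℕ) :
    ∃ a b : ℝ → ℝ, ContDiff ℝ ∞ a ∧ HasCompactSupport a ∧ ContDiff ℝ ∞ b ∧ HasCompactSupport b ∧
      ∫ x, a x = 1 ∧ ∀ x, 2 * a (2 * x) - a x = iteratedDeriv (m + 1) b x := by
  have hdil : ∀ g : ℝ → ℝ, HasCompactSupport g → HasCompactSupport fun x => g (2 * x) :=
    fun g hg => hg.comp_homeomorph (Homeomorph.mulLeft₀ (2 : ℝ) two_ne_zero)
  have hint : ∀ g : ℝ → ℝ, ∫ x, g (2 * x) = 2⁻¹ * ∫ x, g x := fun g => by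
    rw [Measure.integral_comp_mul_left]; norm_num
  have hintg : ∀ {g : ℝ → ℝ}, ContDiff ℝ ∞ g → HasCompactSupport g → Integrable g :=
    fun h h' => h.continuous.integrable_of_hasCompactSupport h'
  have hsm : ∀ {g : ℝ → ℝ}, ContDiff ℝ ∞ g → ContDiff ℝ ∞ fun x => g (2 * x) :=
    fun h => h.comp (contDiff_const.mul contDiff_id)
  induction m with
  | zero =>
    let φ : ContDiffBump (0 : ℝ) := default
    let a : ℝ → ℝ := φ.normed volume
    have ha : ContDiff ℝ ∞ a := φ.contDiff_normed
    have hac : HasCompactSupport a := φ.hasCompactSupport_normed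
    have hai : ∫ x, a x = 1 := φ.integral_normed
    obtain ⟨b, hb, hbc, hd⟩ := exists_contDiff_hasCompactSupport_deriv_eq
      (g := fun x => 2 * a (2 * x) - a x) ((contDiff_const.mul (hsm ha)).sub ha)
      ((hdil a hac).mul_left.sub hac) (by
        rw [integral_sub ((hintg (hsm ha) (hdil a hac)).const_mul 2) (hintg ha hac),
          integral_const_mul, hint, hai]; norm_num)
    refine ⟨a, b, ha, hac, hb, hbc, hai, fun x => ?_⟩
    rw [zero_add, iteratedDeriv_one, hd]
  | succ m ih =>
    obtain ⟨a, b, ha, hac, hb, hbc, hai, hab⟩ := ih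
    set q : ℝ := 2 ^ (m + 1) with hq
    have hq1 : q - 1 ≠ 0 := by
      have : (1 : ℝ) < q := one_lt_pow₀ one_lt_two (Nat.succ_ne_zero m)
      linarith
    obtain ⟨b', hb', hbc', hd⟩ := exists_contDiff_hasCompactSupport_deriv_eq
      (g := fun x => (q - 1)⁻¹ * (2 * b (2 * x) - b x))
      (contDiff_const.mul ((contDiff_const.mul (hsm hb)).sub hb))
      ((hdil b hbc).mul_left.sub hbc).mul_left (by
        rw [integral_const_mul, integral_sub ((hintg (hsm hb) (hdil b hbc)).const_mul 2)
          (hintg hb hbc), integral_const_mul, hint]; ring)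
    -- Richardson extrapolation. With `(D g)(x) = 2 g(2x)`, the new mollifier is `(q D - 1) a / (q -
    -- 1)`, and `D - 1` sends it to `(q D - 1) b^{(m+1)} / (q - 1)`. Since `(D b)^{(m+1)} = q D
    -- (b^{(m+1)})`, this is the derivative of order `m + 1` of `(D - 1) b / (q - 1)`, which has
    -- integral zero and therefore one more compactly supported primitive.
    refine ⟨fun x => (q - 1)⁻¹ * (q * (2 * a (2 * x)) - a x), b',
      contDiff_const.mul ((contDiff_const.mul (contDiff_const.mul (hsm ha))).sub ha),
      ((hdil a hac).mul_left.mul_left.sub hac).mul_left, hb', hbc', ?_, fun x => ?_⟩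
    · rw [integral_const_mul,
        integral_sub (((hintg (hsm ha) (hdil a hac)).const_mul 2).const_mul q) (hintg ha hac),
        integral_const_mul, integral_const_mul, hint, hai]
      field_simp
    · have e1 := hab (2 * x)
      have e2 := hab x
      have hbm : ContDiff ℝ (m + 1 : ℕ) b := hb.of_le (by exact_mod_cast le_top)
      have e3 : iteratedDeriv (m + 1) (fun x => (q - 1)⁻¹ * (2 * b (2 * x) - b x)) x
          = (q - 1)⁻¹ * (2 * (q * iteratedDeriv (m + 1) b (2 * x)) - iteratedDeriv (m + 1) b x) := by
        have h2 : ContDiff ℝ (m + 1 : ℕ) fun x => b (2 * x) :=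
          hbm.comp (contDiff_const.mul contDiff_id)
        rw [iteratedDeriv_const_mul_field, iteratedDeriv_fun_sub
          (contDiff_const.mul h2).contDiffAt hbm.contDiffAt, iteratedDeriv_const_mul_field,
          congrFun (iteratedDeriv_comp_const_mul hbm 2) x]
      rw [iteratedDeriv_succ', hd, e3, ← e1, ← e2]
      ring

/-! ### Tensor product kernels and their derivatives. -/

/-- The tensor product `w ↦ ∏ j, h j (w j)` of functions of one variable. -/
noncomputable def tensorFun {n : ℕ} (h : Fin n → ℝ → ℝ) (w : EuclideanSpace ℝ (Fin n)) : ℝ :=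
  ∏ j, h j (w j)

namespace tensorFun

variable {n : ℕ} {h : Fin n → ℝ → ℝ}

open scoped ContDiff in
lemma contDiff (hh : ∀ j, ContDiff ℝ ∞ (h j)) : ContDiff ℝ ∞ (tensorFun h) :=
  contDiff_prod fun j _ => (hh j).comp (EuclideanSpace.proj (𝕜 := ℝ) j).contDiff

lemma hasCompactSupport (hh : ∀ j, HasCompactSupport (h j)) : HasCompactSupport (tensorFun h) := by
  have hK : IsCompact (Set.univ.pi fun j => tsupport (h j)) :=
    isCompact_univ_pi fun j => (hh j).isCompact
  refine HasCompactSupport.intro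
    ((EuclideanSpace.equiv (Fin n) ℝ).toHomeomorph.isCompact_preimage.2 hK) fun w hw => ?_
  simp only [Set.mem_preimage, Set.mem_univ_pi, not_forall] at hw
  obtain ⟨j, hj⟩ := hw
  exact Finset.prod_eq_zero (Finset.mem_univ j) (image_eq_zero_of_notMem_tsupport hj)

lemma integral_eq (h : Fin n → ℝ → ℝ) : ∫ w, tensorFun h w = ∏ j, ∫ x, h j x := by
  rw [← integral_fintype_prod_volume_eq_prod,
    ← (EuclideanSpace.volume_preserving_symm_measurableEquiv_toLp (Fin n)).integral_comp']
  rfl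

lemma update_apply (h : Fin n → ℝ → ℝ) (i : Fin n) (F : ℝ → ℝ) (w : EuclideanSpace ℝ (Fin n)) :
    tensorFun (Function.update h i F) w = F (w i) * ∏ j ∈ Finset.univ.erase i, h j (w j) := by
  rw [tensorFun, ← Finset.mul_prod_erase _ _ (Finset.mem_univ i), Function.update_self]
  congr 1
  exact Finset.prod_congr rfl fun j hj => by rw [Function.update_of_ne (Finset.ne_of_mem_erase hj)]

/-- Differentiating a rescaled tensor product in a coordinate direction differentiates the
corresponding factor. -/
lemma lineDeriv_update_comp (h : Fin n → ℝ → ℝ) (i : Fin n) {F : ℝ → ℝ} (hF : Differentiable ℝ F)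
    (x y : EuclideanSpace ℝ (Fin n)) (t : ℝ) :
    lineDeriv ℝ (fun y => tensorFun (Function.update h i F) (t⁻¹ • (x - y))) y
        (EuclideanSpace.single i (1 : ℝ))
      = -t⁻¹ * tensorFun (Function.update h i (deriv F)) (t⁻¹ • (x - y)) := by
  refine HasLineDerivAt.lineDeriv ?_
  rw [HasLineDerivAt, update_apply]
  have hin : HasDerivAt (fun r : ℝ => t⁻¹ * (x i - (y i + r))) (-t⁻¹) 0 := by
    have := (((hasDerivAt_id (0 : ℝ)).const_add (y i)).const_sub (x i)).const_mul t⁻¹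
    simpa using this
  have hF' : HasDerivAt (fun r : ℝ => F (t⁻¹ * (x i - (y i + r))))
      (deriv F (t⁻¹ * (x i - y i)) * -t⁻¹) 0 := by
    refine HasDerivAt.comp (0 : ℝ) (h₂ := F) ?_ hin
    simpa using (hF (t⁻¹ * (x i - y i))).hasDerivAt
  refine ((hF'.mul_const (∏ j ∈ Finset.univ.erase i, h j (t⁻¹ * (x j - y j)))).congr_deriv
    ?_).congr_of_eventuallyEq (.of_forall fun r => ?_)
  · simp only [PiLp.smul_apply, PiLp.sub_apply, smul_eq_mul]
    ring
  · dsimp only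
    rw [update_apply]
    congr 1
    · simp
    · refine Finset.prod_congr rfl fun j hj => ?_
      simp [Finset.ne_of_mem_erase hj]

end tensorFun

/-- Telescoping: the factors `A` are exchanged for `B` one coordinate at a time, and the `i`-th
exchange leaves `D` in slot `i`, `B` before it and `A` after it. -/
lemma prod_sub_prod_eq_sum_tensorFun {n : ℕ} (A B D : ℝ → ℝ) (hD : ∀ x, A x - B x = D x)
    (w : EuclideanSpace ℝ (Fin n)) :
    tensorFun (fun _ => A) w - tensorFun (fun _ => B) w
      = ∑ i, tensorFun (Function.update (fun j => if j < i then B else A) i D) w := by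
  have := Finset.prod_sub_ordered Finset.univ (fun j => A (w j)) (fun j => A (w j) - B (w j))
  simp only [sub_sub_cancel] at this
  rw [tensorFun, tensorFun, this, sub_sub_cancel]
  refine Finset.sum_congr rfl fun i _ => ?_
  rw [tensorFun.update_apply, hD, mul_assoc]
  congr 1
  have hs : (Finset.univ.erase i : Finset (Fin n))
      = (Finset.univ.filter (· < i)).disjUnion (Finset.univ.filter (i < ·))
        (Finset.disjoint_filter.2 fun j _ h h' => lt_asymm h h') := by
    ext j
    simp [lt_or_lt_iff_ne]
  rw [hs, Finset.prod_disjUnion]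
  congr 1
  · exact Finset.prod_congr rfl fun j hj => by rw [if_pos (Finset.mem_filter.1 hj).2]
  · exact Finset.prod_congr rfl fun j hj => by rw [if_neg (Finset.mem_filter.1 hj).2.not_gt]

open scoped ContDiff in
/-- A rescaled and reflected smooth kernel, centred at `x`, is a test function on `Ω` as soon as
the ball carrying it is contained in `Ω`. -/
lemma exists_testFunction_eq_comp_smul_sub {n : ℕ} {Ω : Opens (EuclideanSpace ℝ (Fin n))}
    {η : EuclideanSpace ℝ (Fin n) → ℝ} (hη : ContDiff ℝ ∞ η) {R : ℝ}
    (hR : ∀ w, R < ‖w‖ → η w = 0) {t : ℝ} (ht : 0 < t) {x : EuclideanSpace ℝ (Fin n)}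
    (hx : Metric.closedBall x (R * t) ⊆ Ω) :
    ∃ ψ : 𝓓(Ω, ℝ), ∀ y, ψ y = η (t⁻¹ • (x - y)) := by
  have hs : tsupport (fun y => η (t⁻¹ • (x - y))) ⊆ Metric.closedBall x (R * t) := by
    refine closure_minimal (fun y hy => ?_) Metric.isClosed_closedBall
    by_contra h
    refine hy (hR _ ?_)
    rw [Metric.mem_closedBall, not_le, dist_comm, dist_eq_norm] at h
    rw [norm_smul, norm_inv, Real.norm_of_nonneg ht.le, inv_mul_eq_div, lt_div_iff₀ ht]
    exact h
  exact ⟨⟨fun y => η (t⁻¹ • (x - y)), hη.comp ((contDiff_const.sub contDiff_id).const_smul t⁻¹),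
    (isCompact_closedBall x (R * t)).of_isClosed_subset (isClosed_tsupport _) hs, hs.trans hx⟩,
    fun _ => rfl⟩

-- Each derivative in direction `i` falls on the factor in slot `i` alone and costs `-t⁻¹`. This is
-- why only pure derivatives of `f` enter later.
open scoped ContDiff in
lemma iteratedLineDerivOp_const_tensorFun {n : ℕ} {Ω : Opens (EuclideanSpace ℝ (Fin n))}
    (h : Fin n → ℝ → ℝ) (i : Fin n) {F : ℝ → ℝ} (hF : ContDiff ℝ ∞ F)
    (x : EuclideanSpace ℝ (Fin n)) (t : ℝ) (ψ : 𝓓(Ω, ℝ))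
    (hψ : ∀ y, ψ y = tensorFun (Function.update h i F) (t⁻¹ • (x - y))) (k : ℕ)
    (y : EuclideanSpace ℝ (Fin n)) :
    (∂^{fun _ : Fin k => EuclideanSpace.single i (1 : ℝ)} ψ) y
      = (-t⁻¹) ^ k * tensorFun (Function.update h i (iteratedDeriv k F)) (t⁻¹ • (x - y)) := by
  induction k generalizing y with
  | zero => simp [hψ]
  | succ k ih =>
    rw [LineDeriv.iteratedLineDerivOp_succ_left]
    change (∂_{EuclideanSpace.single i (1 : ℝ)}
      (∂^{fun _ : Fin k => EuclideanSpace.single i (1 : ℝ)} ψ)) y = _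
    rw [TestFunction.lineDerivOp_eq_lineDerivCLM (𝕜 := ℝ),
      TestFunction.lineDerivCLM_apply_of_le (by simp)]
    have hd : Differentiable ℝ (iteratedDeriv k F) :=
      hF.differentiable_iteratedDeriv k (by exact_mod_cast WithTop.coe_lt_top k)
    have hfun : (⇑(∂^{fun _ : Fin k => EuclideanSpace.single i (1 : ℝ)} ψ) :
        EuclideanSpace ℝ (Fin n) → ℝ) = fun y => (-t⁻¹) ^ k *
          tensorFun (Function.update h i (iteratedDeriv k F)) (t⁻¹ • (x - y)) := funext ih
    rw [hfun]
    have hl := tensorFun.lineDeriv_update_comp h i hd x y t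
    rw [← iteratedDeriv_succ] at hl
    rw [lineDeriv] at hl ⊢
    rw [deriv_const_mul_field, hl]
    ring

/-! ### Bounds for pairings with a kernel at scale `t`. -/

/-- Plays the role of Hölder's inequality: integrated over a ball and with `A` chosen to balance the
two terms, it bounds an `L^1` quantity by the scale and an integral of `p`-th powers. -/
lemma le_add_rpow_mul_rpow {A d p : ℝ} (hA : 0 < A) (hd : 0 ≤ d) (hp : 1 ≤ p) :
    d ≤ A + A ^ (1 - p) * d ^ p := by
  rcases le_or_gt d A with h | h
  · have : 0 ≤ A ^ (1 - p) * d ^ p := by positivity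
    linarith
  · have hd' : 0 < d := hA.trans h
    have h1 : d ^ (1 - p) ≤ A ^ (1 - p) := Real.rpow_le_rpow_of_nonpos hA h.le (by linarith)
    have h2 : d = d ^ (1 - p) * d ^ p := by
      rw [← Real.rpow_add hd', sub_add_cancel, Real.rpow_one]
    calc d = d ^ (1 - p) * d ^ p := h2
      _ ≤ A ^ (1 - p) * d ^ p := by gcongr
      _ ≤ _ := by linarith

section kernelBounds

variable {n : ℕ} {Ω : Opens (EuclideanSpace ℝ (Fin n))} {η : EuclideanSpace ℝ (Fin n) → ℝ}
  {G : EuclideanSpace ℝ (Fin n) → ℝ} {R M t : ℝ} {x : EuclideanSpace ℝ (Fin n)}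

lemma comp_smul_sub_eq_zero (hR : ∀ w, R < ‖w‖ → η w = 0) (ht : 0 < t)
    {y : EuclideanSpace ℝ (Fin n)} (hy : y ∉ Metric.closedBall x (R * t)) :
    η (t⁻¹ • (x - y)) = 0 := by
  refine hR _ ?_
  rw [Metric.mem_closedBall, not_le, dist_comm, dist_eq_norm] at hy
  rwa [norm_smul, norm_inv, Real.norm_of_nonneg ht.le, inv_mul_eq_div, lt_div_iff₀ ht]

lemma hasCompactSupport_comp_smul_sub (hR : ∀ w, R < ‖w‖ → η w = 0) (ht : 0 < t) :
    HasCompactSupport fun y => η (t⁻¹ • (x - y)) :=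
  HasCompactSupport.intro (isCompact_closedBall x (R * t)) fun _ hy =>
    comp_smul_sub_eq_zero hR ht hy

lemma MeasureTheory.LocallyIntegrable.integrable_mul_kernel
    {μ : Measure (EuclideanSpace ℝ (Fin n))} (hG : LocallyIntegrable G μ) (hη : Continuous η)
    (hR : ∀ w, R < ‖w‖ → η w = 0) (ht : 0 < t) :
    Integrable (fun y => G y * η (t⁻¹ • (x - y))) μ := by
  have hκc : Continuous fun y => η (t⁻¹ • (x - y)) := by fun_prop
  simpa [mul_comm] using hG.integrable_smul_left_of_hasCompactSupport hκc
    (hasCompactSupport_comp_smul_sub hR ht)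

lemma enorm_setIntegral_mul_kernel_le (hM : ∀ w, |η w| ≤ M) (hR : ∀ w, R < ‖w‖ → η w = 0)
    (ht : 0 < t) (hx : Metric.closedBall x (R * t) ⊆ Ω) (D : EuclideanSpace ℝ (Fin n) → ℝ) :
    ‖∫ y in (Ω : Set (EuclideanSpace ℝ (Fin n))), D y * η (t⁻¹ • (x - y))‖ₑ
      ≤ ∫⁻ y in Metric.closedBall x (R * t), ENNReal.ofReal (M * |D y|) := by
  have h : ∫ y in (Ω : Set (EuclideanSpace ℝ (Fin n))), D y * η (t⁻¹ • (x - y))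
      = ∫ y in Metric.closedBall x (R * t), D y * η (t⁻¹ • (x - y)) :=
    setIntegral_eq_of_subset_of_forall_sdiff_eq_zero Ω.isOpen.measurableSet hx
      fun y hy => by rw [comp_smul_sub_eq_zero hR ht hy.2, mul_zero]
  rw [h]
  refine (enorm_integral_le_lintegral_enorm _).trans (lintegral_mono fun y => ?_)
  rw [← ofReal_norm, norm_mul, mul_comm]
  exact ENNReal.ofReal_le_ofReal (mul_le_mul_of_nonneg_right (hM _) (norm_nonneg _))

lemma toReal_volume_closedBall (hr : 0 ≤ R * t) :
    (volume (Metric.closedBall x (R * t))).toReal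
      = (R * t) ^ n * (volume (Metric.ball (0 : EuclideanSpace ℝ (Fin n)) 1)).toReal := by
  rw [Measure.addHaar_closedBall _ _ hr, finrank_euclideanSpace_fin, ENNReal.toReal_mul,
    ENNReal.toReal_ofReal (by positivity)]

lemma abs_setIntegral_mul_kernel_le_of_memLp {p : ℝ} (hp : 1 < p) (hM : ∀ w, |η w| ≤ M)
    (hR : ∀ w, R < ‖w‖ → η w = 0)
    (hG : MemLp G (ENNReal.ofReal p) (volume.restrict (Ω : Set (EuclideanSpace ℝ (Fin n)))))
    (ht : 0 < t) (hx : Metric.closedBall x (R * t) ⊆ Ω) {A : ℝ} (hA : 0 < A) :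
    |∫ y in (Ω : Set (EuclideanSpace ℝ (Fin n))), G y * η (t⁻¹ • (x - y))|
      ≤ M * A * (volume (Metric.closedBall x (R * t))).toReal + M * A ^ (1 - p) *
        (∫⁻ y in (Ω : Set (EuclideanSpace ℝ (Fin n))), ENNReal.ofReal (|G y| ^ p)).toReal := by
  have hM0 : 0 ≤ M := (abs_nonneg _).trans (hM 0)
  have hfin : ∫⁻ y in (Ω : Set (EuclideanSpace ℝ (Fin n))), ENNReal.ofReal (|G y| ^ p) ≠ ⊤ := by
    have h := lintegral_rpow_enorm_lt_top_of_eLpNorm_lt_top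
      (by simpa using (by linarith : 0 < p)) ENNReal.ofReal_ne_top hG.2
    rw [ENNReal.toReal_ofReal (by linarith)] at h
    refine (lt_of_le_of_lt (lintegral_mono fun y => ?_) h).ne
    rw [← ofReal_norm, ENNReal.ofReal_rpow_of_nonneg (norm_nonneg _) (by linarith),
      Real.norm_eq_abs]
  have hV : volume (Metric.closedBall x (R * t)) ≠ ⊤ := measure_closedBall_lt_top.ne
  have key := enorm_setIntegral_mul_kernel_le hM hR ht hx G
  have h2 : ∫⁻ y in Metric.closedBall x (R * t), ENNReal.ofReal (M * |G y|)
      ≤ ENNReal.ofReal (M * A) * volume (Metric.closedBall x (R * t))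
        + ENNReal.ofReal (M * A ^ (1 - p)) *
          ∫⁻ y in (Ω : Set (EuclideanSpace ℝ (Fin n))), ENNReal.ofReal (|G y| ^ p) := by
    calc _ ≤ ∫⁻ y in Metric.closedBall x (R * t), (ENNReal.ofReal (M * A)
          + ENNReal.ofReal (M * A ^ (1 - p)) * ENNReal.ofReal (|G y| ^ p)) := by
          refine lintegral_mono fun y => ?_
          rw [← ENNReal.ofReal_mul (by positivity), ← ENNReal.ofReal_add (by positivity)
            (by positivity)]
          refine ENNReal.ofReal_le_ofReal ?_
          have := mul_le_mul_of_nonneg_left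
            (le_add_rpow_mul_rpow hA (abs_nonneg (G y)) hp.le) hM0
          linarith
      _ ≤ _ := by
          rw [lintegral_add_left measurable_const, lintegral_const, Measure.restrict_apply_univ,
            lintegral_const_mul' _ _ ENNReal.ofReal_ne_top]
          gcongr
  have h3 := ENNReal.toReal_mono (by finiteness) (key.trans h2)
  rw [toReal_enorm, Real.norm_eq_abs, ENNReal.toReal_add (by finiteness) (by finiteness),
    ENNReal.toReal_mul, ENNReal.toReal_mul, ENNReal.toReal_ofReal (by positivity),
    ENNReal.toReal_ofReal (by positivity)] at h3
  exact h3

lemma integral_comp_smul_sub (ht : 0 < t) : ∫ y, η (t⁻¹ • (x - y)) = t ^ n * ∫ w, η w := by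
  rw [integral_sub_left_eq_self (fun y => η (t⁻¹ • y)) volume x, Measure.integral_comp_smul,
    finrank_euclideanSpace_fin, inv_pow, inv_inv, abs_of_pos (by positivity), smul_eq_mul]

/-- As the kernel has mean zero, `G y` may be replaced by `G y - G z` for any `z`. Integrating the
resulting bound over `z` in the ball produces the double integral of the energy, and the volume
factor on the left; on the ball `‖z - y‖ ≤ 2 R t` pays for the singular denominator. -/
lemma abs_setIntegral_mul_kernel_le_of_slobodeckijEnergy {p θ : ℝ} (hp : 1 < p) (hθ : 0 < θ)
    (hη : Continuous η) (hM : ∀ w, |η w| ≤ M) (hR : ∀ w, R < ‖w‖ → η w = 0) (hR0 : 0 < R)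
    (h0 : ∫ w, η w = 0)
    (hG : MemLp G (ENNReal.ofReal p) (volume.restrict (Ω : Set (EuclideanSpace ℝ (Fin n)))))
    (hE : slobodeckijEnergy Ω θ p G < ⊤)
    (ht : 0 < t) (hx : Metric.closedBall x (R * t) ⊆ Ω) {A : ℝ} (hA : 0 < A) :
    (volume (Metric.closedBall x (R * t))).toReal *
      |∫ y in (Ω : Set (EuclideanSpace ℝ (Fin n))), G y * η (t⁻¹ • (x - y))|
      ≤ M * A * (volume (Metric.closedBall x (R * t))).toReal ^ 2
        + M * A ^ (1 - p) * (2 * (R * t)) ^ ((n : ℝ) + θ * p) *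
          (slobodeckijEnergy Ω θ p G).toReal := by
  have hM0 : 0 ≤ M := (abs_nonneg _).trans (hM 0)
  set B := Metric.closedBall x (R * t)
  set q := (n : ℝ) + θ * p with hq
  have hq0 : 0 < q := by positivity
  have hV : volume B ≠ ⊤ := measure_closedBall_lt_top.ne
  set c := M * A ^ (1 - p) * (2 * (R * t)) ^ q with hc
  have hc0 : 0 ≤ c := by positivity
  have hκc : Continuous fun y => η (t⁻¹ • (x - y)) := by fun_prop
  have hκs := hasCompactSupport_comp_smul_sub (x := x) hR ht
  have hint := (hG.locallyIntegrable (by simpa using hp.le)).integrable_mul_kernel hη hR ht (x := x)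
  have hzero : ∫ y in (Ω : Set (EuclideanSpace ℝ (Fin n))), η (t⁻¹ • (x - y)) = 0 := by
    rw [setIntegral_eq_integral_of_forall_compl_eq_zero, integral_comp_smul_sub ht, h0, mul_zero]
    exact fun y hy => comp_smul_sub_eq_zero hR ht fun h => hy (hx h)
  have hsub : ∀ z, ∫ y in (Ω : Set (EuclideanSpace ℝ (Fin n))), G y * η (t⁻¹ • (x - y))
      = ∫ y in (Ω : Set (EuclideanSpace ℝ (Fin n))), (G z - G y) * -η (t⁻¹ • (x - y)) := by
    intro z
    have : ∀ y, (G z - G y) * -η (t⁻¹ • (x - y))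
        = G y * η (t⁻¹ • (x - y)) - G z * η (t⁻¹ • (x - y)) := fun y => by ring
    simp_rw [this]
    rw [integral_sub hint ((hκc.integrable_of_hasCompactSupport hκs).integrableOn.const_mul _),
      integral_const_mul, hzero, mul_zero, sub_zero]
  set I := ∫ y in (Ω : Set (EuclideanSpace ℝ (Fin n))), G y * η (t⁻¹ • (x - y)) with hI
  have hpt : ∀ z ∈ B, ∀ y ∈ B, ENNReal.ofReal (M * |G z - G y|) ≤ ENNReal.ofReal (M * A)
      + ENNReal.ofReal c * ENNReal.ofReal (|G z - G y| ^ p / ‖z - y‖ ^ q) := by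
    intro z hz y hy
    rw [← ENNReal.ofReal_mul hc0, ← ENNReal.ofReal_add (by positivity) (by positivity)]
    refine ENNReal.ofReal_le_ofReal ?_
    have h1 := mul_le_mul_of_nonneg_left
      (le_add_rpow_mul_rpow hA (abs_nonneg (G z - G y)) hp.le) hM0
    have h2 : |G z - G y| ^ p ≤ (2 * (R * t)) ^ q * (|G z - G y| ^ p / ‖z - y‖ ^ q) := by
      rcases eq_or_ne z y with rfl | hne
      · simp [Real.zero_rpow (by linarith : p ≠ 0)]
      · have hpos : 0 < ‖z - y‖ := norm_pos_iff.2 (sub_ne_zero.2 hne)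
        have hle : ‖z - y‖ ≤ 2 * (R * t) := by
          have := dist_triangle_right z y x
          rw [Metric.mem_closedBall] at hz hy
          rw [← dist_eq_norm]; linarith
        have hle' : ‖z - y‖ ^ q ≤ (2 * (R * t)) ^ q :=
          Real.rpow_le_rpow hpos.le hle hq0.le
        rw [mul_div_assoc', le_div_iff₀ (by positivity), mul_comm]
        gcongr
    have h3 := mul_le_mul_of_nonneg_left h2 (by positivity : 0 ≤ M * A ^ (1 - p))
    calc _ ≤ _ := h1
      _ = M * A + M * A ^ (1 - p) * |G z - G y| ^ p := by ring
      _ ≤ _ := by rw [hc]; linarith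
  have hBm : MeasurableSet B := Metric.isClosed_closedBall.measurableSet
  have key : ∀ z ∈ B, ‖I‖ₑ ≤ ENNReal.ofReal (M * A) * volume B + ENNReal.ofReal c *
      ∫⁻ y in (Ω : Set (EuclideanSpace ℝ (Fin n))),
        ENNReal.ofReal (|G z - G y| ^ p / ‖z - y‖ ^ q) := by
    intro z hz
    rw [hsub z]
    refine (enorm_setIntegral_mul_kernel_le (η := fun w => -η w) (fun w => by
      rw [abs_neg]; exact hM w) (fun w hw => by rw [hR w hw, neg_zero]) ht hx
      fun y => G z - G y).trans ?_
    refine (setLIntegral_mono' hBm (hpt z hz)).trans ?_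
    rw [lintegral_add_left measurable_const, lintegral_const, Measure.restrict_apply_univ,
      lintegral_const_mul' _ _ ENNReal.ofReal_ne_top]
    gcongr
  have htot : volume B * ‖I‖ₑ ≤ ENNReal.ofReal (M * A) * volume B * volume B
      + ENNReal.ofReal c * slobodeckijEnergy Ω θ p G := by
    calc volume B * ‖I‖ₑ = ∫⁻ _ in B, ‖I‖ₑ := by
          rw [lintegral_const, Measure.restrict_apply_univ, mul_comm]
      _ ≤ _ := setLIntegral_mono' hBm key
      _ ≤ _ := by
          rw [lintegral_add_left measurable_const, lintegral_const, Measure.restrict_apply_univ,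
            lintegral_const_mul' _ _ ENNReal.ofReal_ne_top, slobodeckijEnergy]
          gcongr
  have hE' := hE.ne
  have h3 := ENNReal.toReal_mono (by finiteness) htot
  rw [ENNReal.toReal_mul, toReal_enorm, Real.norm_eq_abs,
    ENNReal.toReal_add (by finiteness) (by finiteness), ENNReal.toReal_mul, ENNReal.toReal_mul,
    ENNReal.toReal_mul, ENNReal.toReal_ofReal (by positivity), ENNReal.toReal_ofReal hc0] at h3
  rw [pow_two, ← mul_assoc (M * A)]
  exact h3

/-- Pairing with a mean zero kernel at scale `t` gains the factor `t ^ (n + θ - n / p)`. -/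
lemma exists_abs_setIntegral_mul_kernel_le {p θ : ℝ} (hp : 1 < p) (hθ : 0 ≤ θ)
    (hη : Continuous η) (hM : ∀ w, |η w| ≤ M) (hR : ∀ w, R < ‖w‖ → η w = 0) (hR0 : 0 < R)
    (h0 : ∫ w, η w = 0)
    (hG : MemLp G (ENNReal.ofReal p) (volume.restrict (Ω : Set (EuclideanSpace ℝ (Fin n)))))
    (hE : 0 < θ → slobodeckijEnergy Ω θ p G < ⊤) :
    ∃ C, ∀ t : ℝ, 0 < t → ∀ x, Metric.closedBall x (R * t) ⊆ (Ω : Set (EuclideanSpace ℝ (Fin n))) →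
      |∫ y in (Ω : Set (EuclideanSpace ℝ (Fin n))), G y * η (t⁻¹ • (x - y))|
        ≤ C * (t ^ n * t ^ (θ - n / p)) := by
  set ω := (volume (Metric.ball (0 : EuclideanSpace ℝ (Fin n)) 1)).toReal with hω
  have hω0 : 0 < ω := ENNReal.toReal_pos (Metric.measure_ball_pos volume _ one_pos).ne'
    measure_ball_lt_top.ne
  have hp0 : p ≠ 0 := by linarith
  rcases hθ.eq_or_lt with rfl | hθ'
  · set N := (∫⁻ y in (Ω : Set (EuclideanSpace ℝ (Fin n))), ENNReal.ofReal (|G y| ^ p)).toReal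
    refine ⟨M * (R ^ n * ω) + M * N, fun t ht x hx => ?_⟩
    have h := abs_setIntegral_mul_kernel_le_of_memLp hp hM hR hG ht hx
      -- This `A` gives `A t^n` and `A^{1-p}` the same order `t^{n - n/p}`.
      (A := t ^ (0 - n / p)) (by positivity)
    rw [toReal_volume_closedBall (by positivity), ← hω, ← Real.rpow_mul ht.le] at h
    have he : t ^ ((0 - n / p) * (1 - p)) = t ^ n * t ^ (0 - n / p) := by
      rw [← Real.rpow_natCast, ← Real.rpow_add ht]
      congr 1
      field_simp
      ring
    rw [he, mul_pow] at h
    exact h.trans_eq (by ring)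
  · set N := (slobodeckijEnergy Ω θ p G).toReal
    set q := (n : ℝ) + θ * p with hq
    refine ⟨M * (R ^ n * ω) + M * (2 * R) ^ q * N / (R ^ n * ω), fun t ht x hx => ?_⟩
    have h := abs_setIntegral_mul_kernel_le_of_slobodeckijEnergy hp hθ' hη hM hR hR0 h0 hG
      -- Balances `A t^{2n}` with `A^{1-p} t^{n + θ p}`; both have order `t^{2n + θ - n/p}`, and
      -- dividing by the volume of the ball removes `t^n`.
      (hE hθ') ht hx (A := t ^ (θ - n / p)) (by positivity)
    rw [toReal_volume_closedBall (by positivity), ← hω, ← Real.rpow_mul ht.le, ← mul_assoc 2,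
      Real.mul_rpow (by positivity) ht.le, mul_pow] at h
    have he : t ^ ((θ - n / p) * (1 - p)) * t ^ q = t ^ n * t ^ n * t ^ (θ - n / p) := by
      rw [← Real.rpow_natCast, ← Real.rpow_add ht, ← Real.rpow_add ht, ← Real.rpow_add ht]
      congr 1
      rw [hq]
      field_simp
      ring
    rw [← mul_le_mul_iff_right₀ (by positivity : 0 < R ^ n * t ^ n * ω)]
    refine h.trans_eq ?_
    have : M * t ^ ((θ - n / p) * (1 - p)) * ((2 * R) ^ q * t ^ q) * N
        = M * (2 * R) ^ q * N * (t ^ n * t ^ n * t ^ (θ - n / p)) := by rw [← he]; ring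
    rw [← hq, this]
    field_simp

end kernelBounds

/-! ### Convergence of averages at dyadic scales. -/

open Filter Topology in
/-- A sequence of continuous functions whose increments decay geometrically near every point of
`S`, from some index on, converges on `S` to a function that is continuous there. -/
lemma exists_continuousOn_tendsto_of_le_geometric {X : Type*} [TopologicalSpace X] {S : Set X}
    {T : ℕ → X → ℝ} (hT : ∀ j, Continuous (T j)) {C r : ℝ} (hr0 : 0 ≤ r) (hr : r < 1)
    (h : ∀ x₀ ∈ S, ∃ U ∈ 𝓝 x₀, ∃ J, ∀ j ≥ J, ∀ x ∈ U, |T (j + 1) x - T j x| ≤ C * r ^ j) :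
    ∃ v : X → ℝ, ContinuousOn v S ∧ ∀ x ∈ S, Tendsto (fun j => T j x) atTop (𝓝 (v x)) := by
  -- `limUnder` gives one candidate limit on all of `X`, independent of the choices of `U` and `J`.
  have hv : ∀ x₀ ∈ S, ∃ U ∈ 𝓝 x₀, ∃ J, ∀ x ∈ U,
      Tendsto (fun j => T j x) atTop (𝓝 (limUnder atTop fun j => T j x)) ∧
      ∀ j, dist (T (j + J) x) (limUnder atTop fun j => T j x) ≤ C * r ^ J * r ^ j / (1 - r) := by
    intro x₀ hx₀
    obtain ⟨U, hU, J, hJ⟩ := h x₀ hx₀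
    refine ⟨U, hU, J, fun x hx => ?_⟩
    have hd : ∀ j, dist (T (j + J) x) (T (j + 1 + J) x) ≤ C * r ^ J * r ^ j := fun j => by
      rw [dist_comm, Real.dist_eq, mul_assoc, ← pow_add, add_comm J j, add_right_comm]
      exact hJ _ (Nat.le_add_left J j) x hx
    have hc := cauchySeq_of_le_geometric r _ hr hd
    obtain ⟨l, hl⟩ := cauchySeq_tendsto_of_complete hc
    have hl' : Tendsto (fun j => T j x) atTop (𝓝 l) := (tendsto_add_atTop_iff_nat J).1 hl
    rw [hl'.limUnder_eq]
    exact ⟨hl', fun j => dist_le_of_le_geometric_of_tendsto r _ hr hd hl j⟩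
  refine ⟨fun x => limUnder atTop fun j => T j x, fun x₀ hx₀ => ?_, fun x₀ hx₀ => ?_⟩
  · obtain ⟨U, hU, J, hJ⟩ := hv x₀ hx₀
    have hu : TendstoUniformlyOn (fun j => T (j + J)) (fun x => limUnder atTop fun j => T j x)
        atTop U := by
      rw [Metric.tendstoUniformlyOn_iff]
      intro ε hε
      have hlim : Tendsto (fun j => C * r ^ J * r ^ j / (1 - r)) atTop (𝓝 0) := by
        simpa using ((tendsto_pow_atTop_nhds_zero_of_lt_one hr0 hr).const_mul
          (C * r ^ J)).div_const (1 - r)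
      filter_upwards [hlim.eventually_lt_const hε] with j hj x hx
      rw [dist_comm]
      exact ((hJ x hx).2 j).trans_lt hj
    exact ((hu.continuousOn (.of_forall fun j => (hT _).continuousOn)).continuousAt
      hU).continuousWithinAt
  · obtain ⟨U, hU, J, hJ⟩ := hv x₀ hx₀
    exact (hJ x₀ (mem_of_mem_nhds hU)).1

/-- The average `t⁻ⁿ ∫_Ω f(y) η((x - y) / t) dy` of `f` against the kernel `η` at scale `t`. -/
noncomputable def kernelAverage {n : ℕ} (Ω : Opens (EuclideanSpace ℝ (Fin n)))
    (f η : EuclideanSpace ℝ (Fin n) → ℝ) (t : ℝ) (x : EuclideanSpace ℝ (Fin n)) : ℝ :=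
  (t ^ n)⁻¹ * ∫ y in (Ω : Set (EuclideanSpace ℝ (Fin n))), f y * η (t⁻¹ • (x - y))

section kernelAverage

variable {n : ℕ} {Ω : Opens (EuclideanSpace ℝ (Fin n))} {f η : EuclideanSpace ℝ (Fin n) → ℝ}
  {R M t : ℝ} {x : EuclideanSpace ℝ (Fin n)}

lemma continuous_kernelAverage
    (hf : LocallyIntegrable f (volume.restrict (Ω : Set (EuclideanSpace ℝ (Fin n)))))
    (hη : Continuous η) (hR : ∀ w, R < ‖w‖ → η w = 0) (ht : 0 < t) :
    Continuous (kernelAverage Ω f η t) := by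
  have hs : HasCompactSupport fun z => η (t⁻¹ • z) := by
    simpa [Function.comp_def] using (hasCompactSupport_comp_smul_sub (x := 0) hR ht).comp_homeomorph
      (Homeomorph.neg (EuclideanSpace ℝ (Fin n)))
  -- The average is a convolution for the measure restricted to `Ω`, hence continuous on the whole
  -- space, even where the kernel's ball leaves `Ω`.
  exact continuous_const.mul (hs.continuous_convolution_right (ContinuousLinearMap.mul ℝ ℝ) hf
    (hη.comp (continuous_const_smul _)))

open Filter Topology in
/-- Averages against a bounded compactly supported kernel of integral one converge almost
everywhere. -/
lemma ae_tendsto_kernelAverage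
    (hf : LocallyIntegrable f (volume.restrict (Ω : Set (EuclideanSpace ℝ (Fin n)))))
    (hη : Continuous η) (hM : ∀ w, |η w| ≤ M) (hR : ∀ w, R < ‖w‖ → η w = 0) (hR0 : 0 < R)
    (h1 : ∫ w, η w = 1) :
    ∀ᵐ x ∂volume.restrict (Ω : Set (EuclideanSpace ℝ (Fin n))),
      Tendsto (fun j : ℕ => kernelAverage Ω f η ((1 / 2) ^ j) x) atTop (𝓝 (f x)) := by
  have hΩm : MeasurableSet (Ω : Set (EuclideanSpace ℝ (Fin n))) := Ω.isOpen.measurableSet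
  -- Extension by zero, so that Lebesgue differentiation for the full volume applies.
  set F := (Ω : Set (EuclideanSpace ℝ (Fin n))).indicator f with hF
  have hFl : LocallyIntegrable F volume := fun x => by
    obtain ⟨U, hU, hi⟩ := hf x
    refine ⟨U, hU, ?_⟩
    rw [IntegrableOn, hF, integrable_indicator_iff hΩm, IntegrableOn,
      Measure.restrict_comm hΩm]
    exact hi
  have hTF : ∀ t x, kernelAverage Ω f η t x = (t ^ n)⁻¹ * ∫ y, F y * η (t⁻¹ • (x - y)) := by
    intro t x
    rw [kernelAverage, ← integral_indicator hΩm]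
    congr 2 with y
    by_cases hy : y ∈ (Ω : Set (EuclideanSpace ℝ (Fin n))) <;> simp [hF, hy]
  rw [ae_restrict_iff' hΩm]
  filter_upwards [IsUnifLocDoublingMeasure.ae_tendsto_average_norm_sub volume hFl 1] with x hx hxΩ
  have hFx : F x = f x := Set.indicator_of_mem hxΩ f
  rw [← hFx, tendsto_iff_norm_sub_tendsto_zero]
  have hδ : Tendsto (fun j : ℕ => R * (1 / 2 : ℝ) ^ j) atTop (𝓝[>] 0) := by
    refine tendsto_nhdsWithin_iff.2 ⟨?_, .of_forall fun j => by
      rw [Set.mem_Ioi]; positivity⟩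
    simpa using (tendsto_pow_atTop_nhds_zero_of_lt_one (by norm_num : (0 : ℝ) ≤ 1 / 2)
      (by norm_num)).const_mul R
  have hlim := (hx (fun _ => x) _ hδ (.of_forall fun j => by
    simp only [one_mul]
    exact Metric.mem_closedBall_self (by positivity))).const_mul
      (M * (R ^ n * (volume (Metric.ball (0 : EuclideanSpace ℝ (Fin n)) 1)).toReal))
  rw [mul_zero] at hlim
  refine squeeze_zero (fun _ => norm_nonneg _) (fun j => ?_) hlim
  set t : ℝ := (1 / 2) ^ j
  have ht : 0 < t := by positivity
  set B := Metric.closedBall x (R * t)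
  have hBt := toReal_volume_closedBall (x := x) (R := R) (t := t) (by positivity)
  have hB0 : (volume B).toReal ≠ 0 :=
    (ENNReal.toReal_pos (Metric.measure_closedBall_pos volume _ (by positivity)).ne'
      measure_closedBall_lt_top.ne).ne'
  have hκ : Integrable (fun y => η (t⁻¹ • (x - y))) :=
    Continuous.integrable_of_hasCompactSupport (by fun_prop)
      (hasCompactSupport_comp_smul_sub hR ht)
  have hi := hFl.integrable_mul_kernel hη hR ht (x := x)
  -- As `∫ η = 1`, subtracting `F x` amounts to averaging `F y - F x`, which the mean oscillation of
  -- `F` on the ball controls.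
  have e1 : kernelAverage Ω f η t x - F x
      = (t ^ n)⁻¹ * ∫ y in B, (F y - F x) * η (t⁻¹ • (x - y)) := by
    rw [setIntegral_eq_integral_of_forall_compl_eq_zero (fun y hy => by
      rw [comp_smul_sub_eq_zero hR ht hy, mul_zero])]
    simp_rw [sub_mul]
    rw [integral_sub hi (hκ.const_mul _), integral_const_mul, integral_comp_smul_sub ht, h1,
      hTF, mul_sub]
    congr 1
    field_simp
  have hBi : IntegrableOn (fun y => ‖F y - F x‖) B :=
    ((hFl.integrableOn_isCompact (isCompact_closedBall _ _)).sub
      (integrableOn_const measure_closedBall_lt_top.ne)).norm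
  have e2 : ‖∫ y in B, (F y - F x) * η (t⁻¹ • (x - y))‖ ≤ M * ∫ y in B, ‖F y - F x‖ := by
    rw [← integral_const_mul]
    refine norm_integral_le_of_norm_le (hBi.const_mul M) (.of_forall fun y => ?_)
    rw [norm_mul, mul_comm]
    exact mul_le_mul_of_nonneg_right (hM _) (norm_nonneg _)
  rw [e1, norm_mul, Real.norm_of_nonneg (by positivity : 0 ≤ (t ^ n)⁻¹), setAverage_eq,
    measureReal_def, smul_eq_mul]
  calc _ ≤ (t ^ n)⁻¹ * (M * ∫ y in B, ‖F y - F x‖) := by gcongr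
    _ = (t ^ n)⁻¹ * M * (volume B).toReal * ((volume B).toReal⁻¹ * ∫ y in B, ‖F y - F x‖) := by
        field_simp
    _ = _ := by
        have : (t ^ n)⁻¹ * M * (volume B).toReal
            = M * (R ^ n * (volume (Metric.ball (0 : EuclideanSpace ℝ (Fin n)) 1)).toReal) := by
          rw [hBt, mul_pow]
          field_simp
        rw [this]

/-- The kernel `w ↦ ∏_{j < i} a(w_j) · b(w_i) · ∏_{j > i} 2 a(2 w_j)`. -/
noncomputable def dilationKernel (a b : ℝ → ℝ) (i : Fin n) : EuclideanSpace ℝ (Fin n) → ℝ :=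
  tensorFun (Function.update (fun j => if j < i then a else fun x => 2 * a (2 * x)) i b)

open scoped ContDiff in
lemma contDiff_dilationKernel {a b : ℝ → ℝ} (ha : ContDiff ℝ ∞ a) (hb : ContDiff ℝ ∞ b)
    (i : Fin n) : ContDiff ℝ ∞ (dilationKernel a b i) := by
  refine tensorFun.contDiff fun j => ?_
  rcases eq_or_ne j i with rfl | hj
  · rwa [Function.update_self]
  · rw [Function.update_of_ne hj]
    split_ifs
    · exact ha
    · exact contDiff_const.mul (ha.comp (contDiff_const.mul contDiff_id))

lemma hasCompactSupport_dilationKernel {a b : ℝ → ℝ} (ha : HasCompactSupport a)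
    (hb : HasCompactSupport b) (i : Fin n) : HasCompactSupport (dilationKernel a b i) := by
  refine tensorFun.hasCompactSupport fun j => ?_
  rcases eq_or_ne j i with rfl | hj
  · rwa [Function.update_self]
  · rw [Function.update_of_ne hj]
    split_ifs
    · exact ha
    · exact (ha.comp_homeomorph (Homeomorph.mulLeft₀ (2 : ℝ) two_ne_zero)).mul_left

lemma integral_dilationKernel {a b : ℝ → ℝ} (hb : ∫ x, b x = 0) (i : Fin n) :
    ∫ w, dilationKernel a b i w = 0 := by
  rw [dilationKernel, tensorFun.integral_eq]
  exact Finset.prod_eq_zero (Finset.mem_univ i) (by rwa [Function.update_self])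

open scoped ContDiff in
/-- Halving the scale of a tensor product mollifier changes the average of `f` by averages of its
pure weak derivatives of order `k`. -/
lemma kernelAverage_half_sub {k : ℕ}
    (hf : LocallyIntegrable f (volume.restrict (Ω : Set (EuclideanSpace ℝ (Fin n)))))
    {a b : ℝ → ℝ} (ha : ContDiff ℝ ∞ a) (hb : ContDiff ℝ ∞ b)
    (hab : ∀ x, 2 * a (2 * x) - a x = iteratedDeriv k b x)
    {g : Fin n → EuclideanSpace ℝ (Fin n) → ℝ}
    (hg : ∀ i, IsWeakDeriv Ω (fun _ : Fin k => i) f (g i))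
    (hR : ∀ (i : Fin n) w, R < ‖w‖ → dilationKernel a b i w = 0)
    (hRa : ∀ w : EuclideanSpace ℝ (Fin n), R < ‖w‖ → tensorFun (fun _ => a) w = 0)
    (ht : 0 < t) (hx : Metric.closedBall x (R * t) ⊆ Ω) :
    kernelAverage Ω f (tensorFun fun _ => a) (t / 2) x
        - kernelAverage Ω f (tensorFun fun _ => a) t x
      = ∑ i, t ^ k * kernelAverage Ω (g i) (dilationKernel a b i) t x := by
  have hfi : ∀ i, ∃ ψ : 𝓓(Ω, ℝ), ∀ y, ψ y = dilationKernel a b i (t⁻¹ • (x - y)) := fun i =>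
    exists_testFunction_eq_comp_smul_sub (contDiff_dilationKernel ha hb i) (hR i) ht hx
  choose ψ hψ using hfi
  have hd := fun i => iteratedLineDerivOp_const_tensorFun
    (fun j => if j < i then a else fun x => 2 * a (2 * x)) i hb x t (ψ i) (hψ i) k
  set e : Fin n → EuclideanSpace ℝ (Fin n) → ℝ := fun i y =>
    (∂^{fun _ : Fin k => EuclideanSpace.single i (1 : ℝ)} (ψ i)) y with he
  -- `2 ^ n` is the ratio of the normalisations at scales `t / 2` and `t`; `(-t) ^ k` undoes the
  -- factor from the `k` derivatives.
  have hscale : ∀ y, 2 ^ n * tensorFun (fun _ => a) ((t / 2)⁻¹ • (x - y))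
      - tensorFun (fun _ => a) (t⁻¹ • (x - y)) = (-t) ^ k * ∑ i, e i y := by
    intro y
    have h1 : 2 ^ n * tensorFun (fun _ => a) ((t / 2)⁻¹ • (x - y))
        = tensorFun (fun _ x => 2 * a (2 * x)) (t⁻¹ • (x - y)) := by
      simp only [tensorFun, Finset.prod_mul_distrib, Finset.prod_const, Finset.card_univ,
        Fintype.card_fin, PiLp.smul_apply, PiLp.sub_apply, smul_eq_mul]
      congr 1
      refine Finset.prod_congr rfl fun j _ => ?_
      congr 1
      field_simp
    rw [h1, prod_sub_prod_eq_sum_tensorFun _ _ _ hab, Finset.mul_sum]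
    refine Finset.sum_congr rfl fun i _ => ?_
    rw [he]
    dsimp only
    rw [hd i y, ← mul_assoc, ← mul_pow]
    have : -t * -t⁻¹ = 1 := by field_simp
    rw [this, one_pow, one_mul]
  have hei : ∀ i, Integrable (fun y => f y * e i y)
      (volume.restrict (Ω : Set (EuclideanSpace ℝ (Fin n)))) := fun i => by
    have := hf.integrable_smul_left_of_hasCompactSupport
      (TestFunction.continuous (∂^{fun _ : Fin k => EuclideanSpace.single i (1 : ℝ)} (ψ i)))
      (TestFunction.hasCompactSupport _)
    exact this.congr (.of_forall fun y => mul_comm _ _)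
  have hρ : Continuous (tensorFun (n := n) fun _ => a) := (tensorFun.contDiff fun _ => ha).continuous
  have hi1 := hf.integrable_mul_kernel hρ hRa ht (x := x)
  have hi2 := hf.integrable_mul_kernel hρ hRa (half_pos ht) (x := x)
  have hint : kernelAverage Ω f (tensorFun fun _ => a) (t / 2) x
        - kernelAverage Ω f (tensorFun fun _ => a) t x
      = (t ^ n)⁻¹ * ((-t) ^ k * ∑ i, ∫ y in (Ω : Set (EuclideanSpace ℝ (Fin n))), f y * e i y) := by
    rw [← integral_finsetSum _ fun i _ => hei i, ← integral_const_mul, kernelAverage, kernelAverage]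
    have h2 : ((t / 2) ^ n)⁻¹ = (t ^ n)⁻¹ * 2 ^ n := by rw [div_pow, inv_div]; ring
    rw [h2, mul_assoc, ← integral_const_mul, ← mul_sub,
      ← integral_sub (hi2.const_mul _) hi1]
    congr 2 with y
    rw [← Finset.mul_sum, mul_left_comm _ (f y), mul_left_comm _ (f y), ← hscale y]
    ring
  rw [hint, Finset.mul_sum, Finset.mul_sum]
  refine Finset.sum_congr rfl fun i _ => ?_
  have hw := hg i (ψ i)
  rw [he]
  dsimp only
  rw [hw, kernelAverage]
  simp_rw [hψ]
  -- The sign of the weak derivative cancels the one from the reflected argument `x - y`.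
  have : (-t) ^ k * (-1) ^ k = t ^ k := by rw [← mul_pow]; simp
  rw [← this]
  ring

end kernelAverage

lemma exists_forall_norm_lt_eq_zero {ι E : Type*} [Finite ι] [NormedAddCommGroup E]
    {η : ι → E → ℝ} (h : ∀ i, HasCompactSupport (η i)) :
    ∃ R, 0 < R ∧ ∀ i w, R < ‖w‖ → η i w = 0 := by
  obtain ⟨R, hR0, hR⟩ :=
    (isCompact_iUnion fun i => (h i).isCompact).isBounded.subset_closedBall_lt 0 0
  refine ⟨R, hR0, fun i w hw => image_eq_zero_of_notMem_tsupport fun h' => ?_⟩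
  have := hR (Set.mem_iUnion_of_mem i h')
  rw [mem_closedBall_zero_iff] at this
  linarith

/-! ### The Sobolev embedding. -/

open Filter Topology in
/-- **Sobolev embedding**: a function in `W^{s,p}(Ω)` with `s p > n` agrees almost everywhere with a
function that is continuous on `Ω`. -/
theorem MemSobolevSlobodeckij.exists_continuousOn_ae_eq {n : ℕ}
    {Ω : Opens (EuclideanSpace ℝ (Fin n))} {s p : ℝ} (hp : 1 < p) (hsp : (n : ℝ) < s * p)
    {f : EuclideanSpace ℝ (Fin n) → ℝ} (hf : MemSobolevSlobodeckij Ω s p f) :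
    ∃ v : EuclideanSpace ℝ (Fin n) → ℝ,
      ContinuousOn v (Ω : Set (EuclideanSpace ℝ (Fin n))) ∧
      f =ᵐ[volume.restrict (Ω : Set (EuclideanSpace ℝ (Fin n)))] v := by
  have hp0 : 0 < p := by linarith
  have hs : 0 < s := pos_of_mul_pos_left (n.cast_nonneg.trans_lt hsp) hp0.le
  set k := ⌊s⌋₊
  have hθ : 0 ≤ s - k := sub_nonneg.2 (Nat.floor_le hs.le)
  obtain ⟨hfp, hder⟩ := hf
  have hfl := hfp.locallyIntegrable (by simpa using hp.le)
  choose g hgp hgw hgE using fun i : Fin n => hder k le_rfl fun _ => i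
  obtain ⟨a, b, ha, hac, hb, hbc, hai, hab⟩ := exists_mollifier_dilation_sub_eq_iteratedDeriv k
  have hb' := (contDiff_infty_iff_deriv.1 hb).2
  have hbi : ∫ x, deriv b x = 0 :=
    integral_eq_zero_of_hasDerivAt_of_integrable
      (fun x => (hb.differentiable (by simp) x).hasDerivAt)
      (hb'.continuous.integrable_of_hasCompactSupport hbc.deriv)
      (hb.continuous.integrable_of_hasCompactSupport hbc)
  -- One of the `k + 1` derivatives stays on `b`: `k` of them are moved onto `f`, and the factor
  -- `b'` gives the kernels mean zero.
  rw [iteratedDeriv_succ'] at hab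
  set η : Fin n → EuclideanSpace ℝ (Fin n) → ℝ := dilationKernel a (deriv b)
  have hηs := fun i : Fin n => contDiff_dilationKernel ha hb' i
  have hηc := fun i : Fin n => hasCompactSupport_dilationKernel hac hbc.deriv i
  set ρ : EuclideanSpace ℝ (Fin n) → ℝ := tensorFun fun _ => a with hρ
  have hρs := (tensorFun.contDiff (n := n) fun _ => ha).continuous
  have hρc := tensorFun.hasCompactSupport (n := n) fun _ => hac
  have hρi : ∫ w, ρ w = 1 := by rw [hρ, tensorFun.integral_eq]; simp [hai]
  -- A common support radius for `ρ` (the value at `none`) and all the `η i`.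
  obtain ⟨R, hR0, hR⟩ := exists_forall_norm_lt_eq_zero
    (η := fun o : Option (Fin n) => o.elim ρ η) (fun o => by cases o; exacts [hρc, hηc _])
  have hRη : ∀ i w, R < ‖w‖ → η i w = 0 := fun i => hR (some i)
  have hRρ : ∀ w, R < ‖w‖ → ρ w = 0 := hR none
  have hbd : ∀ i, ∃ C, ∀ t : ℝ, 0 < t → ∀ x, Metric.closedBall x (R * t) ⊆
      (Ω : Set (EuclideanSpace ℝ (Fin n))) →
      |∫ y in (Ω : Set (EuclideanSpace ℝ (Fin n))), g i y * η i (t⁻¹ • (x - y))|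
        ≤ C * (t ^ n * t ^ ((s - k) - n / p)) := fun i => by
    obtain ⟨M, hM⟩ := (hηc i).exists_bound_of_continuous (hηs i).continuous
    exact exists_abs_setIntegral_mul_kernel_le hp hθ (hηs i).continuous hM (hRη i) hR0
      (integral_dilationKernel hbi i) (hgp i) (hgE i rfl)
  choose C hC using hbd
  set γ := s - n / p with hγ
  have hγ0 : 0 < γ := by rw [hγ, sub_pos, div_lt_iff₀ hp0]; exact hsp
  have hstep : ∀ t : ℝ, 0 < t → ∀ x, Metric.closedBall x (R * t) ⊆
      (Ω : Set (EuclideanSpace ℝ (Fin n))) →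
      |kernelAverage Ω f ρ (t / 2) x - kernelAverage Ω f ρ t x| ≤ (∑ i, C i) * t ^ γ := by
    intro t ht x hx
    rw [kernelAverage_half_sub hfl ha hb' (fun x => hab x) hgw hRη hRρ ht hx, Finset.sum_mul]
    refine (Finset.abs_sum_le_sum_abs _ _).trans (Finset.sum_le_sum fun i _ => ?_)
    rw [kernelAverage, abs_mul, abs_mul, abs_of_pos (by positivity), abs_of_pos (by positivity)]
    calc _ ≤ t ^ k * ((t ^ n)⁻¹ * (C i * (t ^ n * t ^ ((s - k) - n / p)))) := by
          gcongr
          exact hC i t ht x hx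
      _ = C i * (t ^ (k : ℝ) * t ^ ((s - k) - n / p)) := by
          rw [Real.rpow_natCast]
          field_simp
      _ = C i * t ^ γ := by
          rw [← Real.rpow_add ht, hγ]
          congr 2
          ring
  obtain ⟨v, hv, hlim⟩ := exists_continuousOn_tendsto_of_le_geometric
    (S := (Ω : Set (EuclideanSpace ℝ (Fin n))))
    (T := fun j => kernelAverage Ω f ρ ((1 / 2) ^ j)) (C := ∑ i, C i) (r := (1 / 2) ^ γ)
    (fun j => continuous_kernelAverage hfl hρs hRρ (by positivity)) (by positivity)
    (Real.rpow_lt_one (by norm_num) (by norm_num) hγ0) (fun x₀ hx₀ => by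
      obtain ⟨ε, hε, hεΩ⟩ := Metric.isOpen_iff.1 Ω.isOpen x₀ hx₀
      have hl : Tendsto (fun j : ℕ => R * (1 / 2 : ℝ) ^ j) atTop (𝓝 0) := by
        simpa using (tendsto_pow_atTop_nhds_zero_of_lt_one (by norm_num : (0 : ℝ) ≤ 1 / 2)
          (by norm_num)).const_mul R
      -- From `J` on, the kernel's ball about any point of `ball x₀ (ε / 2)` lies in `ball x₀ ε ⊆
      -- Ω`.
      obtain ⟨J, hJ⟩ := eventually_atTop.1 (hl.eventually_lt_const (half_pos hε))
      refine ⟨Metric.ball x₀ (ε / 2), Metric.ball_mem_nhds _ (half_pos hε), J,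
        fun j hj x hx => ?_⟩
      have h := hstep ((1 / 2) ^ j) (by positivity) x (fun y hy => hεΩ (by
        have h1 := hJ j hj
        have h2 := dist_triangle y x x₀
        rw [Metric.mem_closedBall] at hy
        rw [Metric.mem_ball] at hx ⊢
        linarith))
      rw [Real.rpow_pow_comm (by norm_num), pow_succ, mul_one_div]
      exact h)
  refine ⟨v, hv, ?_⟩
  obtain ⟨M, hM⟩ := hρc.exists_bound_of_continuous hρs
  filter_upwards [ae_tendsto_kernelAverage hfl hρs hM hRρ hR0 hρi,
    ae_restrict_mem Ω.isOpen.measurableSet] with x hx hxΩ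
  exact tendsto_nhds_unique hx (hlim x hxΩ)

/-! ### Gluing the local continuous versions. -/

section gluing

variable {n : ℕ} {Ω : Opens (EuclideanSpace ℝ (Fin n))}

open scoped ContDiff in
/-- The fundamental lemma of the calculus of variations on an open subset of `Ω`. -/
lemma ae_eq_of_forall_testFunction_integral_eq {W : Set (EuclideanSpace ℝ (Fin n))}
    (hW : IsOpen W) (hWΩ : W ⊆ Ω) {f g : EuclideanSpace ℝ (Fin n) → ℝ}
    (hf : LocallyIntegrableOn f (Ω : Set (EuclideanSpace ℝ (Fin n))) volume)
    (hg : LocallyIntegrableOn g (Ω : Set (EuclideanSpace ℝ (Fin n))) volume)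
    (h : ∀ ψ : 𝓓(Ω, ℝ), tsupport ψ ⊆ W →
      ∫ x in (Ω : Set (EuclideanSpace ℝ (Fin n))), f x * ψ x
        = ∫ x in (Ω : Set (EuclideanSpace ℝ (Fin n))), g x * ψ x) :
    f =ᵐ[volume.restrict W] g := by
  have key : ∀ᵐ x ∂volume, x ∈ W → f x - g x = 0 := by
    refine hW.ae_eq_zero_of_integral_contDiff_smul_eq_zero ((hf.sub hg).mono_set hWΩ)
      fun φ hφ hc hs => ?_
    let ψ : 𝓓(Ω, ℝ) := ⟨φ, hφ, hc, hs.trans hWΩ⟩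
    have hint : ∀ {F : EuclideanSpace ℝ (Fin n) → ℝ},
        LocallyIntegrableOn F (Ω : Set (EuclideanSpace ℝ (Fin n))) volume →
        Integrable (fun x => F x * ψ x) := fun hF => by
      simpa [mul_comm] using ψ.integrable_bilin (ContinuousLinearMap.mul ℝ ℝ) hF
    have hset : ∀ F : EuclideanSpace ℝ (Fin n) → ℝ,
        ∫ x in (Ω : Set (EuclideanSpace ℝ (Fin n))), F x * ψ x = ∫ x, F x * ψ x := fun F =>
      setIntegral_eq_integral_of_forall_compl_eq_zero fun x hx => by
        rw [image_eq_zero_of_notMem_tsupport fun h' => hx (ψ.tsupport_subset h'), mul_zero]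
    have h' := h ψ hs
    rw [hset, hset] at h'
    calc ∫ x, φ x • (f x - g x) = ∫ x, (f x * ψ x - g x * ψ x) := by
          congr 1 with x
          change φ x * (f x - g x) = f x * φ x - g x * φ x
          ring
      _ = 0 := by rw [integral_sub (hint hf) (hint hg), h', sub_self]
  rw [Filter.EventuallyEq, ae_restrict_iff' hW.measurableSet]
  filter_upwards [key] with x hx hxW using sub_eq_zero.1 (hx hxW)

open Filter Topology in
open scoped Manifold ContDiff in
lemma exists_testFunction_eventually_nhdsSet_eq_one {K : Set (EuclideanSpace ℝ (Fin n))}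
    (hK : IsCompact K) (hKΩ : K ⊆ Ω) : ∃ φ : 𝓓(Ω, ℝ), ∀ᶠ x in 𝓝ˢ K, φ x = 1 := by
  obtain ⟨L, hL, hKL, hLΩ⟩ := exists_compact_between hK Ω.isOpen hKΩ
  obtain ⟨f, h1, h0, -⟩ := exists_contMDiffMap_one_nhds_of_subset_interior
    (n := ⊤) 𝓘(ℝ, EuclideanSpace ℝ (Fin n)) hK.isClosed hKL
  have hs : tsupport f ⊆ L := closure_minimal
    (fun x hx => by_contra fun h => hx (h0 x h)) hL.isClosed
  exact ⟨⟨f, f.contMDiff.contDiff, hL.of_isClosed_subset (isClosed_tsupport _) hs,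
    hs.trans hLΩ⟩, h1⟩

lemma TestFunction.pointwiseMul_eq_right {φ ψ : 𝓓(Ω, ℝ)} (h : ∀ x ∈ tsupport ψ, φ x = 1) :
    φ.pointwiseMul ψ = ψ := by
  ext x
  change φ x * ψ x = ψ x
  by_cases hx : x ∈ tsupport ψ
  · rw [h x hx, one_mul]
  · rw [image_eq_zero_of_notMem_tsupport hx, mul_zero]

end gluing

open Filter Topology in
theorem mainTheorem11 {n : ℕ} (hn : 0 < n) (Ω : Opens (EuclideanSpace ℝ (Fin n)))
    (hne : (Ω : Set (EuclideanSpace ℝ (Fin n))).Nonempty)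
    (hΩ : (Ω : Set (EuclideanSpace ℝ (Fin n))) = Set.univ ∨
      (Bornology.IsBounded (Ω : Set (EuclideanSpace ℝ (Fin n))) ∧
        HasLipschitzBoundary (Ω : Set (EuclideanSpace ℝ (Fin n)))) ∨
      HasInteriorLipschitzProperty Ω)
    (s p : ℝ) (hp : 1 < p) (hsp : (n : ℝ) < s * p)
    (u : 𝓓'(Ω, ℝ)) (hu : MemSobolevSlobodeckijLoc s p u) :
    ∃ v : EuclideanSpace ℝ (Fin n) → ℝ,
      ContinuousOn v (Ω : Set (EuclideanSpace ℝ (Fin n))) ∧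
      IsGivenBy (u : 𝓓(Ω, ℝ) →ₗ[ℝ] ℝ) v ∧
      ∀ w : EuclideanSpace ℝ (Fin n) → ℝ, IsGivenBy (u : 𝓓(Ω, ℝ) →ₗ[ℝ] ℝ) w →
        w =ᵐ[volume.restrict (Ω : Set (EuclideanSpace ℝ (Fin n)))] v := by
  have hΩm : MeasurableSet (Ω : Set (EuclideanSpace ℝ (Fin n))) := Ω.isOpen.measurableSet
  have hloc : ∀ φ : 𝓓(Ω, ℝ), ∃ V : EuclideanSpace ℝ (Fin n) → ℝ,
      ContinuousOn V (Ω : Set (EuclideanSpace ℝ (Fin n))) ∧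
      ∀ ψ : 𝓓(Ω, ℝ), u (φ.pointwiseMul ψ)
        = ∫ x in (Ω : Set (EuclideanSpace ℝ (Fin n))), V x * ψ x := fun φ => by
    obtain ⟨f, hfu, hf⟩ := hu φ
    obtain ⟨V, hV, hfV⟩ := hf.exists_continuousOn_ae_eq hp hsp
    refine ⟨V, hV, fun ψ => (hfu.2 ψ).trans (integral_congr_ae ?_)⟩
    filter_upwards [hfV] with x hx
    rw [hx]
  choose V hVc hVu using hloc
  -- Two cutoffs equal to `1` near `x` give the same distribution there, so their continuous
  -- versions agree almost everywhere near `x`, and by continuity at `x` itself.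
  have hcompat : ∀ φ₁ φ₂ : 𝓓(Ω, ℝ), ∀ x ∈ (Ω : Set (EuclideanSpace ℝ (Fin n))),
      (∀ᶠ y in 𝓝 x, φ₁ y = 1) → (∀ᶠ y in 𝓝 x, φ₂ y = 1) → V φ₁ x = V φ₂ x := by
    intro φ₁ φ₂ x hx h₁ h₂
    obtain ⟨W, hWs, hWo, hxW⟩ := mem_nhds_iff.1 (inter_mem (inter_mem h₁ h₂)
      (Ω.isOpen.mem_nhds hx))
    have hWΩ : W ⊆ Ω := fun y hy => (hWs hy).2
    have hae := ae_eq_of_forall_testFunction_integral_eq hWo hWΩ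
      ((hVc φ₁).locallyIntegrableOn hΩm) ((hVc φ₂).locallyIntegrableOn hΩm) (fun ψ hψ => by
        rw [← hVu, ← hVu, TestFunction.pointwiseMul_eq_right fun y hy => (hWs (hψ hy)).1.1,
          TestFunction.pointwiseMul_eq_right fun y hy => (hWs (hψ hy)).1.2])
    exact Measure.eqOn_open_of_ae_eq hae hWo ((hVc φ₁).mono hWΩ) ((hVc φ₂).mono hWΩ) hxW
  have hcut : ∀ x, ∃ φ : 𝓓(Ω, ℝ), x ∈ (Ω : Set (EuclideanSpace ℝ (Fin n))) →
      ∀ᶠ y in 𝓝 x, φ y = 1 := fun x => by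
    by_cases hx : x ∈ (Ω : Set (EuclideanSpace ℝ (Fin n)))
    · obtain ⟨φ, hφ⟩ := exists_testFunction_eventually_nhdsSet_eq_one isCompact_singleton
        (Set.singleton_subset_iff.2 hx)
      exact ⟨φ, fun _ => by rwa [nhdsSet_singleton] at hφ⟩
    · exact ⟨0, fun h => absurd h hx⟩
  choose Φ hΦ using hcut
  have hv : ∀ φ : 𝓓(Ω, ℝ), ∀ x ∈ (Ω : Set (EuclideanSpace ℝ (Fin n))),
      (∀ᶠ y in 𝓝 x, φ y = 1) → V (Φ x) x = V φ x := fun φ x hx h =>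
    hcompat _ _ x hx (hΦ x hx) h
  -- `Φ x` is also equal to `1` near every `y` close to `x`, so the glued function coincides near
  -- `x` with the single continuous function `V (Φ x)`.
  have hcont : ContinuousOn (fun x => V (Φ x) x) (Ω : Set (EuclideanSpace ℝ (Fin n))) := by
    intro x hx
    refine ((hVc (Φ x)).continuousAt (Ω.isOpen.mem_nhds hx)).congr ?_ |>.continuousWithinAt
    filter_upwards [(hΦ x hx).eventually_nhds, Ω.isOpen.mem_nhds hx] with y hy hyΩ
    exact (hv (Φ x) y hyΩ hy).symm
  have hgiven : IsGivenBy (u : 𝓓(Ω, ℝ) →ₗ[ℝ] ℝ) fun x => V (Φ x) x := by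
    refine ⟨hcont.locallyIntegrableOn hΩm, fun ψ => ?_⟩
    -- One cutoff equal to `1` near the whole support of `ψ` gives `φ ψ = ψ`, and there `V φ` is the
    -- glued function.
    obtain ⟨φ, hφ⟩ := exists_testFunction_eventually_nhdsSet_eq_one
      ψ.hasCompactSupport.isCompact ψ.tsupport_subset
    have h := hVu φ ψ
    rw [TestFunction.pointwiseMul_eq_right fun x hx => hφ.self_of_nhdsSet x hx] at h
    refine h.trans (setIntegral_congr_fun hΩm fun x hx => ?_)
    by_cases hxs : x ∈ tsupport ψ
    · dsimp only
      rw [hv φ x hx (hφ.filter_mono (nhds_le_nhdsSet hxs))]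
    · simp [image_eq_zero_of_notMem_tsupport hxs]
  refine ⟨_, hcont, hgiven, fun w hw => ?_⟩
  exact ae_eq_of_forall_testFunction_integral_eq Ω.isOpen le_rfl hw.1 hgiven.1
    fun ψ _ => (hw.2 ψ).symm.trans (hgiven.2 ψ)
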